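/- Let $K$ be a triangulation of 3-space, that is, a finite simplicial complex of dimension at most $2$ that admits a topological embedding into the 3-sphere $S^3$ all of whose chambers (the connected components of the complement of the image of $K$) are tetrahedra. Here a chamber $U$ is a tetrahedron if there are four vertices of $K$, any three of which span a triangle of $K$, such that the embedding of the boundary of the solid tetrahedron $\Delta$ on these four vertices extends to a topological embedding $\Delta\to S^3$ that maps the interior of $\Delta$ onto $U$. Then the vertices of $K$ can be properly coloured with four colours (any two vertices joined by an edge get different colours) if and only if the edges of $K$ can be properly coloured with three colours (any two distinct edges that lie in a common triangle of $K$ get different colours). -/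

import Mathlib

namespace ThreeSpace

/-- 3-space, that is, the 3-sphere `S³`: the unit sphere of `ℝ⁴`. -/
abbrev S3 : Type := Metric.sphere (0 : EuclideanSpace ℝ (Fin 4)) 1

/-- The closed simplex spanned by `s` in barycentric coordinates indexed by all of `V`. -/
def closedSimplex {V : Type*} [Fintype V] (s : Finset V) : Set (V → ℝ) :=
  {x | x ∈ stdSimplex ℝ V ∧ ∀ v, v ∉ s → x v = 0}

/-- The geometric realisation of a finite simplicial complex, with the topology of `ℝ^V`. -/
def realization {V : Type*} [Fintype V] (K : AbstractSimplicialComplex V) : Set (V → ℝ) :=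
  ⋃ s ∈ K.faces, closedSimplex s

/-- A 2-complex: a simplicial complex all of whose simplices have dimension at most two. -/
def IsTwoComplex {V : Type*} (K : AbstractSimplicialComplex V) : Prop :=
  ∀ s ∈ K.faces, s.card ≤ 3

/-- The 1-skeleton of `K`, as a graph on the vertices of `K`. -/
def oneSkeleton {V : Type*} (K : AbstractSimplicialComplex V) : SimpleGraph V where
  Adj u v := u ≠ v ∧ ∃ e ∈ K.faces, e.card = 2 ∧ u ∈ e ∧ v ∈ e
  symm := ⟨fun _ _ ⟨h, e, he, hc, hu, hv⟩ => ⟨h.symm, e, he, hc, hv, hu⟩⟩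
  loopless := ⟨fun _ h => h.1 rfl⟩

/-- The edges of `K`. -/
abbrev Edge {V : Type*} (K : AbstractSimplicialComplex V) : Type _ :=
  {e : Finset V // e ∈ K.faces ∧ e.card = 2}

/-- The spatial line graph of `K`: its vertices are the edges of `K`, and two of them are adjacent
if they lie in a common (triangular) face of `K`. A proper edge colouring of `K` is a proper
vertex colouring of this graph. -/
def spatialLineGraph {V : Type*} (K : AbstractSimplicialComplex V) : SimpleGraph (Edge K) where
  Adj e f := e ≠ f ∧ ∃ t ∈ K.faces, t.card = 3 ∧ e.1 ⊆ t ∧ f.1 ⊆ t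
  symm := ⟨fun _ _ ⟨h, t, ht, hc, he, hf⟩ => ⟨h.symm, t, ht, hc, hf, he⟩⟩
  loopless := ⟨fun _ h => h.1 rfl⟩

/-- `U` is a chamber of the map `φ` from the realisation of `K` to 3-space: a connected component
of the complement of the image. -/
def IsChamber {V : Type*} [Fintype V] {K : AbstractSimplicialComplex V}
    (φ : realization K → S3) (U : Set S3) : Prop :=
  ∃ p ∈ (Set.range φ)ᶜ, U = connectedComponentIn (Set.range φ)ᶜ p

/-- `U` is a tetrahedron of the embedded complex `φ`: there are four vertices of `K`, any three of
which span a face of `K`, and the boundary map of the solid tetrahedron spanned by them that is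
given by `φ` extends to an embedding of the solid tetrahedron that maps the interior onto `U`. -/
def IsTetrahedron {V : Type*} [Fintype V] {K : AbstractSimplicialComplex V}
    (φ : realization K → S3) (U : Set S3) : Prop :=
  ∃ T : Finset V, T.card = 4 ∧ (∀ t ⊆ T, t.card = 3 → t ∈ K.faces) ∧
    ∃ σ : closedSimplex T → S3, Topology.IsEmbedding σ ∧
      (∀ (x : closedSimplex T) (y : realization K),
        (x : V → ℝ) = (y : V → ℝ) → (∃ v ∈ T, x.1 v = 0) → σ x = φ y) ∧
      σ '' {x | ∀ v ∈ T, 0 < x.1 v} = U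

/-- `K` is a triangulation of 3-space: a 2-complex that is embedded in 3-space in such a way that
all chambers are tetrahedra. -/
def IsTriangulation {V : Type*} [Fintype V] (K : AbstractSimplicialComplex V) : Prop :=
  IsTwoComplex K ∧ ∃ φ : realization K → S3, Topology.IsEmbedding φ ∧
    ∀ U, IsChamber φ U → IsTetrahedron φ U

end ThreeSpace

/-!
Identify four vertex colours with the elements of the Klein four-group `G = ZMod 2 × ZMod 2` and
three edge colours with its nonzero elements. The coboundary of a proper vertex colouring is a
proper edge colouring (`colorable_spatialLineGraph`). Conversely, since the three nonzero elements
of `G` add up to zero, a proper edge colouring is a 1-cocycle of `K` with values in `G`, and a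
function on the vertices whose coboundary is this cocycle is a proper vertex colouring. So all that
is needed is that every 1-cocycle of a triangulation of 3-space is a coboundary
(`IsTriangulation.exists_coboundary`), which reflects the simple connectedness of the 3-sphere.

To prove this, assign to each chamber the four vertices of a solid simplex that parametrises it, and
let the open star of a vertex `v` consist of the image of its open star in `K` and of the chambers
to which `v` is assigned. The open stars are an open cover of the sphere (`isOpen_openStar`), and stars with
a common point belong to vertices that lie in a common face or a common tetrahedron. A 1-cocycle of
`K` is therefore a constant Čech cocycle for this cover, that is, transition functions of a
principal bundle with discrete structure group. Such a bundle is a covering, hence has a section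
over the sphere with a point removed; the sections over two punctured spheres differ by a constant
on the connected intersection, so there is a global section (`exists_primitive_sphere`). It is a
family of locally constant functions, one on each open star, and evaluating each of them at the
vertex of its star gives the function on the vertices: along an edge both functions involved are
constant, so that their values can be compared at the midpoint.
-/

namespace ThreeSpace

open Set Topology

/-! ### Constant Čech cocycles and coverings -/

section Cech

variable {ι X G : Type*} [TopologicalSpace X] [AddCommGroup G] [TopologicalSpace G]

/-- The principal bundle with discrete structure group `G` whose transition functions are the
constants `c i j` on the overlaps of the open cover `O`. -/
noncomputable def bundleCore (O : ι → Set X) (hO : ∀ i, IsOpen (O i)) (hcov : ∀ x, ∃ i, x ∈ O i)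
    (c : ι → ι → G)
    (hc : ∀ i j k, (O i ∩ O j ∩ O k).Nonempty → c i j + c j k = c i k)
    [ContinuousAdd G] : FiberBundleCore ι X G where
  baseSet := O
  isOpen_baseSet := hO
  indexAt x := (hcov x).choose
  mem_baseSet_at x := (hcov x).choose_spec
  coordChange i j _ g := g + c i j
  coordChange_self i x hx g := by
    have := hc i i i ⟨x, ⟨hx, hx⟩, hx⟩
    simpa using this
  continuousOn_coordChange i j := (continuous_snd.add continuous_const).continuousOn
  coordChange_comp i j k x hx g := by rw [add_assoc, hc i j k ⟨x, hx⟩]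

/-- Over a simply connected open set a constant Čech cocycle is the coboundary of locally constant
functions: the associated principal bundle is a covering, and the inclusion of a simply connected
set lifts to it. -/
theorem exists_primitive_of_isSimplyConnected [LocallyPathConnectedSpace X] [DiscreteTopology G]
    {O : ι → Set X} (hO : ∀ i, IsOpen (O i)) (hcov : ∀ x, ∃ i, x ∈ O i) {c : ι → ι → G}
    (hc : ∀ i j k, (O i ∩ O j ∩ O k).Nonempty → c i j + c j k = c i k)
    {A : Set X} (hA : IsOpen A) (hAs : IsSimplyConnected A) :
    ∃ h : ι → X → G, (∀ i, ContinuousOn (h i) (O i ∩ A)) ∧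
      ∀ i j, ∀ x ∈ A, x ∈ O i → x ∈ O j → h j x = h i x + c i j := by
  classical
  let Z := bundleCore O hO hcov c hc
  have := hAs.simplyConnectedSpace
  have := hA.locallyPathConnectedSpace
  obtain ⟨a, ha⟩ := hAs.nonempty
  have hZ := FiberBundle.isCoveringMap (F := G) (E := Z.Fiber)
  obtain ⟨s, ⟨-, hs⟩, -⟩ := hZ.existsUnique_continuousMap_lifts
    ⟨((↑) : A → X), continuous_subtype_val⟩ ⟨a, ha⟩ ⟨a, (0 : G)⟩ rfl
  have hs' (x : A) : (s x).proj = x := congrFun hs x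
  refine ⟨fun i x ↦ if hx : x ∈ A then ((Z.localTriv i) (s ⟨x, hx⟩)).2 else 0, fun i ↦ ?_, ?_⟩
  · have hcont : ContinuousOn (fun x : A ↦ ((Z.localTriv i) (s x)).2) ((↑) ⁻¹' O i) := by
      refine continuous_snd.comp_continuousOn
        ((Z.localTriv i).continuousOn.comp s.continuous.continuousOn fun x hx ↦ ?_)
      rw [Z.mem_localTriv_source, ← Z.baseSet_at, hs']
      exact hx
    have hO' : IsOpen (((↑) : A → X) ⁻¹' O i) := (hO i).preimage continuous_subtype_val
    intro x hx
    refine ContinuousAt.continuousWithinAt ?_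
    rw [← hA.isOpenEmbedding_subtypeVal.continuousAt_iff (x := ⟨x, hx.2⟩)]
    refine (hcont.continuousAt (hO'.mem_nhds hx.1)).congr (Filter.Eventually.of_forall fun y ↦ ?_)
    simp
  · intro i j x hx hi hj
    simp only [hx, dif_pos, Z.localTriv_apply, hs']
    -- the coordinate changes of `Z` are translations by the cocycle
    have key (g : G) : g + c (Z.indexAt x) j = g + c (Z.indexAt x) i + c i j := by
      rw [add_assoc, hc _ _ _ ⟨x, ⟨Z.mem_baseSet_at x, hi⟩, hj⟩]
    exact key _

/-- Mayer–Vietoris: primitives of a constant Čech cocycle over two open sets with preconnected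
intersection differ there by a constant, so they can be glued. -/
theorem exists_primitive_of_cover [DiscreteTopology G]
    {O : ι → Set X} (hO : ∀ i, IsOpen (O i)) (hcov : ∀ x, ∃ i, x ∈ O i) {c : ι → ι → G}
    {A B : Set X} (hA : IsOpen A) (hB : IsOpen B) (hAB : A ∪ B = univ)
    (hconn : IsPreconnected (A ∩ B)) {f g : ι → X → G}
    (hf : ∀ i, ContinuousOn (f i) (O i ∩ A))
    (hfc : ∀ i j, ∀ x ∈ A, x ∈ O i → x ∈ O j → f j x = f i x + c i j)
    (hg : ∀ i, ContinuousOn (g i) (O i ∩ B))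
    (hgc : ∀ i j, ∀ x ∈ B, x ∈ O i → x ∈ O j → g j x = g i x + c i j) :
    ∃ h : ι → X → G, (∀ i, ContinuousOn (h i) (O i)) ∧
      ∀ i j, ∀ x, x ∈ O i → x ∈ O j → h j x = h i x + c i j := by
  classical
  choose ind hind using hcov
  -- the difference of the two primitives does not depend on the index
  have hd : ∀ i, ∀ x ∈ A ∩ B, x ∈ O i → f i x - g i x = f (ind x) x - g (ind x) x := by
    intro i x hx hi
    rw [hfc i (ind x) x hx.1 hi (hind x), hgc i (ind x) x hx.2 hi (hind x)]
    abel
  have hcont : ContinuousOn (fun x ↦ f (ind x) x - g (ind x) x) (A ∩ B) := by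
    intro x hx
    have hopen := ((hO (ind x)).inter hA).inter ((hO (ind x)).inter hB)
    have hmem : O (ind x) ∩ A ∩ (O (ind x) ∩ B) ∈ 𝓝 x :=
      hopen.mem_nhds ⟨⟨hind x, hx.1⟩, hind x, hx.2⟩
    have h := (((hf (ind x)).mono inter_subset_left).sub
      ((hg (ind x)).mono inter_subset_right)).continuousAt hmem
    refine (h.congr ?_).continuousWithinAt
    filter_upwards [hmem] with y hy
    exact hd _ y ⟨hy.1.2, hy.2.2⟩ hy.1.1
  obtain ⟨k, hk⟩ : ∃ k, ∀ i, ∀ x ∈ A ∩ B, x ∈ O i → f i x = g i x + k := by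
    rcases (A ∩ B).eq_empty_or_nonempty with he | ⟨y, hy⟩
    · exact ⟨0, fun i x hx ↦ by simp [he] at hx⟩
    · refine ⟨f (ind y) y - g (ind y) y, fun i x hx hi ↦ ?_⟩
      rw [← hconn.constant hcont hx hy, ← hd i x hx hi]
      abel
  refine ⟨fun i x ↦ if x ∈ A then f i x else g i x + k, fun i x hi ↦ ?_, fun i j x hi hj ↦ ?_⟩
  · refine ContinuousAt.continuousWithinAt ?_
    rcases (hAB ▸ mem_univ x : x ∈ A ∪ B) with hx | hx
    · have hmem := ((hO i).inter hA).mem_nhds ⟨hi, hx⟩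
      refine ((hf i).continuousAt hmem).congr ?_
      filter_upwards [hmem] with y hy
      rw [if_pos hy.2]
    · have hmem := ((hO i).inter hB).mem_nhds ⟨hi, hx⟩
      refine (((hg i).add (continuousOn_const (c := k))).continuousAt hmem).congr ?_
      filter_upwards [hmem] with y hy
      split_ifs with hyA
      · exact (hk i y ⟨hyA, hy.2⟩ hy.1).symm
      · rfl
  · dsimp only
    split_ifs with hx
    · exact hfc i j x hx hi hj
    · have hxB : x ∈ B := (hAB ▸ mem_univ x : x ∈ A ∪ B).resolve_left hx
      rw [hgc i j x hxB hi hj]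
      abel

end Cech

/-! ### Punctured spheres -/

instance : Fact (Module.finrank ℝ (EuclideanSpace ℝ (Fin 4)) = 3 + 1) := ⟨by simp⟩

instance : LocallyPathConnectedSpace S3 :=
  ChartedSpace.locallyPathConnectedSpace (EuclideanSpace ℝ (Fin 3)) S3

theorem isSimplyConnected_compl_singleton (p : S3) : IsSimplyConnected ({p}ᶜ : Set S3) := by
  rw [← range_stereographic_symm (norm_eq_of_mem_sphere p) p.2, ← image_univ,
    (isOpenEmbedding_stereographic_symm _).isEmbedding.isSimplyConnected_image]
  have := (Homeomorph.Set.univ (ℝ ∙ (p : EuclideanSpace ℝ (Fin 4)))ᗮ).contractibleSpace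
  exact SimplyConnectedSpace.ofContractible _

theorem isPreconnected_compl_antipodal (p : S3) :
    IsPreconnected ({p}ᶜ ∩ {-p}ᶜ : Set S3) := by
  set e := stereographic (norm_eq_of_mem_sphere p)
  have he : (e.symm '' {0}ᶜ : Set S3) = {p}ᶜ ∩ {-p}ᶜ := by
    have h0 : e.symm 0 = -p := by
      rw [← stereographic_apply_neg p]
      refine e.left_inv ?_
      simp only [e, stereographic_source, mem_compl_iff, mem_singleton_iff]
      exact fun h ↦ ne_neg_of_mem_unit_sphere ℝ p (by simpa using h.symm)
    have hinj := (isOpenEmbedding_stereographic_symm (norm_eq_of_mem_sphere p)).injective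
    rw [compl_eq_univ_sdiff, image_sdiff hinj, image_univ, image_singleton, h0,
      range_stereographic_symm (norm_eq_of_mem_sphere p) p.2]
    rfl
  rw [← he]
  refine (IsConnected.isPreconnected ?_).image _
    (isOpenEmbedding_stereographic_symm _).continuous.continuousOn
  refine isConnected_compl_singleton_of_one_lt_rank ?_ 0
  have hp : (p : EuclideanSpace ℝ (Fin 4)) ≠ 0 := ne_zero_of_mem_unit_sphere p
  rw [← Module.finrank_eq_rank, Submodule.finrank_orthogonal_span_singleton (n := 3) hp]
  norm_num

/-- Constant Čech cocycles on the 3-sphere are coboundaries: this is the consequence of simple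
connectedness that is needed, obtained from two antipodal punctured spheres. -/
theorem exists_primitive_sphere {ι G : Type*} [AddCommGroup G] [TopologicalSpace G]
    [DiscreteTopology G] {O : ι → Set S3} (hO : ∀ i, IsOpen (O i)) (hcov : ∀ x, ∃ i, x ∈ O i)
    {c : ι → ι → G}
    (hc : ∀ i j k, (O i ∩ O j ∩ O k).Nonempty → c i j + c j k = c i k) :
    ∃ h : ι → S3 → G, (∀ i, ContinuousOn (h i) (O i)) ∧
      ∀ i j, ∀ x, x ∈ O i → x ∈ O j → h j x = h i x + c i j := by
  obtain ⟨p⟩ : Nonempty S3 := (NormedSpace.sphere_nonempty.2 zero_le_one).to_subtype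
  obtain ⟨f, hf, hfc⟩ := exists_primitive_of_isSimplyConnected hO hcov hc
    isOpen_compl_singleton (isSimplyConnected_compl_singleton p)
  obtain ⟨g, hg, hgc⟩ := exists_primitive_of_isSimplyConnected hO hcov hc
    isOpen_compl_singleton (isSimplyConnected_compl_singleton (-p))
  refine exists_primitive_of_cover hO hcov isOpen_compl_singleton isOpen_compl_singleton ?_
    (isPreconnected_compl_antipodal p) hf hfc hg hgc
  refine eq_univ_of_forall fun x ↦ ?_
  by_cases hx : x = p
  · exact Or.inr fun h ↦ ne_neg_of_mem_unit_sphere ℝ p (hx.symm.trans h)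
  · exact Or.inl hx

/-! ### The cover by open stars -/

/-- Let `W` be the open star of a vertex in the closed subspace `R`, and let `P` select those
components of the complement of `R` that are to be added to it. If the frontier of every other
component misses `W`, then the resulting set is open. Infinitely many components cause no problem:
a small connected neighbourhood of a point of `W` that meets such a component without meeting its
frontier is contained in it, but components do not meet `W`. -/
theorem isOpen_union_components {X : Type*} [TopologicalSpace X] [LocallyConnectedSpace X]
    {R W : Set X} (hR : IsClosed R) (hWR : W ⊆ R) (hW : IsClosed (R \ W)) {P : Set X → Prop}
    (hP : ∀ p ∈ Rᶜ, ¬ P (connectedComponentIn Rᶜ p) →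
      frontier (connectedComponentIn Rᶜ p) ⊆ R \ W) :
    IsOpen (W ∪ {p | p ∈ Rᶜ ∧ P (connectedComponentIn Rᶜ p)}) := by
  rw [isOpen_iff_mem_nhds]
  rintro p (hp | ⟨hp, hpP⟩)
  · refine Filter.mem_of_superset
      (connectedComponentIn_mem_nhds (hW.isOpen_compl.mem_nhds fun h ↦ h.2 hp)) fun q hq ↦ ?_
    by_cases hqR : q ∈ R
    · by_contra hqW
      exact connectedComponentIn_subset _ _ hq ⟨hqR, fun h ↦ hqW (Or.inl h)⟩
    refine Or.inr ⟨hqR, ?_⟩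
    by_contra hqP
    have hU : IsOpen (connectedComponentIn Rᶜ q) := hR.isOpen_compl.connectedComponentIn
    have hsub : connectedComponentIn (R \ W)ᶜ p ⊆ connectedComponentIn Rᶜ q := by
      refine isPreconnected_connectedComponentIn.subset_of_closure_inter_subset hU
        ⟨q, hq, mem_connectedComponentIn hqR⟩ fun y hy ↦ ?_
      by_contra hyU
      refine connectedComponentIn_subset _ _ hy.2 (hP q hqR hqP ?_)
      rw [hU.frontier_eq]
      exact ⟨hy.1, hyU⟩
    have hpU := hsub (mem_connectedComponentIn fun h : p ∈ R \ W ↦ h.2 hp)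
    exact connectedComponentIn_subset _ _ hpU (hWR hp)
  · refine Filter.mem_of_superset (connectedComponentIn_mem_nhds (hR.isOpen_compl.mem_nhds hp))
      fun q hq ↦ Or.inr ⟨connectedComponentIn_subset _ _ hq, ?_⟩
    rwa [← connectedComponentIn_eq hq]

section Complex

variable {V : Type*} [Fintype V] {K : AbstractSimplicialComplex V}

theorem isCompact_closedSimplex (s : Finset V) : IsCompact (closedSimplex s) := by
  have : closedSimplex s = stdSimplex ℝ V ∩ ⋂ v, ⋂ (_ : v ∉ s), {x | x v = 0} := by
    ext x
    simp [closedSimplex]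
  rw [this]
  exact (isCompact_stdSimplex ℝ V).inter_right (isClosed_iInter fun v ↦ isClosed_iInter fun _ ↦
    isClosed_eq (continuous_apply v) continuous_const)

theorem convex_closedSimplex (s : Finset V) : Convex ℝ (closedSimplex s) := by
  intro x hx y hy a b ha hb hab
  exact ⟨convex_stdSimplex ℝ V hx.1 hy.1 ha hb hab, fun v hv ↦ by simp [hx.2 v hv, hy.2 v hv]⟩

theorem closedSimplex_subset_realization {s : Finset V} (hs : s ∈ K.faces) :
    closedSimplex s ⊆ realization K :=
  subset_biUnion_of_mem (u := fun s ↦ closedSimplex s) hs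

theorem isCompact_realization (K : AbstractSimplicialComplex V) : IsCompact (realization K) :=
  (toFinite K.faces).isCompact_biUnion fun s _ ↦ isCompact_closedSimplex s

theorem single_mem_closedSimplex [DecidableEq V] {s : Finset V} {v : V} (hv : v ∈ s) :
    (Pi.single v 1 : V → ℝ) ∈ closedSimplex s :=
  ⟨single_mem_stdSimplex ℝ v, fun w hw ↦ Pi.single_eq_of_ne (fun h : w = v ↦ hw (h ▸ hv)) _⟩

/-- The frontier of a tetrahedron is contained in the image of the subcomplex spanned by its four
vertices, and any three of these, possibly with repetitions, lie in a common face. -/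
theorem IsTetrahedron.exists_frontier_subset {φ : realization K → S3} {U : Set S3}
    (h : IsTetrahedron φ U) (hU : IsOpen U) :
    ∃ T : Finset V, T.Nonempty ∧
      (∀ u ∈ T, ∀ v ∈ T, ∀ w ∈ T, ∃ s ∈ K.faces, u ∈ s ∧ v ∈ s ∧ w ∈ s) ∧
      frontier U ⊆ φ '' {y | ∀ v ∉ T, y.1 v = 0} := by
  classical
  obtain ⟨T, hT, hfaces, σ, hσ, hφ, rfl⟩ := h
  refine ⟨T, Finset.card_pos.1 (by omega), fun u hu v hv w hw ↦ ?_, fun p hp ↦ ?_⟩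
  · obtain ⟨t, hut, htT, ht⟩ := Finset.exists_subsuperset_card_eq (s := {u, v, w}) (t := T) (n := 3)
      (by simp [Finset.insert_subset_iff, hu, hv, hw]) Finset.card_le_three (by omega)
    exact ⟨t, hfaces t htT ht, hut (by simp), hut (by simp), hut (by simp)⟩
  · have : CompactSpace (closedSimplex T) :=
      isCompact_iff_compactSpace.1 (isCompact_closedSimplex T)
    have hcl := closure_minimal (image_subset_range σ {x | ∀ v ∈ T, 0 < x.1 v})
      (isCompact_range hσ.continuous).isClosed
    obtain ⟨x, rfl⟩ := hcl (frontier_subset_closure hp)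
    rw [hU.frontier_eq] at hp
    obtain ⟨v, hv, hxv⟩ : ∃ v ∈ T, x.1 v = 0 := by
      by_contra! hne
      exact hp.2 ⟨x, fun v hv ↦ (x.2.1.1 v).lt_of_ne (hne v hv).symm, rfl⟩
    have hx : x.1 ∈ realization K := by
      refine closedSimplex_subset_realization (hfaces (T.erase v) (T.erase_subset v)
        (by rw [Finset.card_erase_of_mem hv, hT])) ⟨x.2.1, fun w hw ↦ ?_⟩
      by_cases hwv : w = v
      · exact hwv ▸ hxv
      · exact x.2.2 w fun hwT ↦ hw (Finset.mem_erase.2 ⟨hwv, hwT⟩)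
    exact ⟨⟨x, hx⟩, fun w hw ↦ x.2.2 w hw, (hφ x ⟨x, hx⟩ rfl ⟨v, hv, hxv⟩).symm⟩

/-- The open star of `v` in 3-space: the image of the open star of `v` in the complex, together
with the chambers to which `T` assigns a tetrahedron with vertex `v`. -/
def openStar (φ : realization K → S3) (T : Set S3 → Finset V) (v : V) : Set S3 :=
  φ '' {y | y.1 v ≠ 0} ∪ {p | p ∈ (range φ)ᶜ ∧ v ∈ T (connectedComponentIn (range φ)ᶜ p)}

theorem isOpen_openStar {φ : realization K → S3} (hφ : IsEmbedding φ) {T : Set S3 → Finset V}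
    (hT : ∀ U, IsChamber φ U → frontier U ⊆ φ '' {y | ∀ v ∉ T U, y.1 v = 0}) (v : V) :
    IsOpen (openStar φ T v) := by
  have : CompactSpace (realization K) := isCompact_iff_compactSpace.1 (isCompact_realization K)
  have hdiff : range φ \ φ '' {y | y.1 v ≠ 0} = φ '' {y | y.1 v = 0} := by
    rw [← image_univ, ← image_sdiff hφ.injective]
    congr 1
    ext y
    simp
  refine isOpen_union_components (P := fun U ↦ v ∈ T U) (isCompact_range hφ.continuous).isClosed
    (image_subset_range _ _) ?_ fun p hp hv ↦ ?_
  · rw [hdiff]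
    have hclosed : IsClosed {y : realization K | y.1 v = 0} :=
      isClosed_eq ((continuous_apply v).comp continuous_subtype_val) continuous_const
    exact (hclosed.isCompact.image hφ.continuous).isClosed
  · rw [hdiff]
    exact (hT _ ⟨p, hp, rfl⟩).trans (image_mono fun y hy ↦ hy v hv)

/-! ### Cocycles on a triangulation of 3-space -/

/-- The vanishing of the first cohomology of a triangulation of 3-space, with coefficients in any
abelian group: every 1-cocycle is the coboundary of a function on the vertices. -/
theorem IsTriangulation.exists_coboundary (hK : IsTriangulation K) {G : Type*} [AddCommGroup G]
    {c : V → V → G}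
    (hc : ∀ u v w, (∃ s ∈ K.faces, u ∈ s ∧ v ∈ s ∧ w ∈ s) → c u v + c v w = c u w) :
    ∃ a : V → G, ∀ s ∈ K.faces, ∀ u ∈ s, ∀ v ∈ s, a v = a u + c u v := by
  classical
  obtain ⟨-, φ, hφ, hch⟩ := hK
  let _ : TopologicalSpace G := ⊥
  have : DiscreteTopology G := ⟨rfl⟩
  have : CompactSpace (realization K) := isCompact_iff_compactSpace.1 (isCompact_realization K)
  have hopen : IsOpen (range φ)ᶜ := (isCompact_range hφ.continuous).isClosed.isOpen_compl
  have hex : ∀ U, ∃ T : Finset V, IsChamber φ U → T.Nonempty ∧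
      (∀ u ∈ T, ∀ v ∈ T, ∀ w ∈ T, ∃ s ∈ K.faces, u ∈ s ∧ v ∈ s ∧ w ∈ s) ∧
      frontier U ⊆ φ '' {y | ∀ v ∉ T, y.1 v = 0} := by
    intro U
    by_cases hU : IsChamber φ U
    · have hUo : IsOpen U := by
        obtain ⟨p, -, rfl⟩ := hU
        exact hopen.connectedComponentIn
      obtain ⟨T, hT⟩ := (hch U hU).exists_frontier_subset hUo
      exact ⟨T, fun _ ↦ hT⟩
    · exact ⟨∅, fun h ↦ absurd h hU⟩
  choose T hT using hex
  have hcov : ∀ p, ∃ v, p ∈ openStar φ T v := by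
    intro p
    by_cases hp : p ∈ range φ
    · obtain ⟨y, rfl⟩ := hp
      obtain ⟨s, hs, hy⟩ := mem_iUnion₂.1 y.2
      obtain ⟨v, hv⟩ : ∃ v, y.1 v ≠ 0 := by
        by_contra! h
        simpa [h] using hy.1.2
      exact ⟨v, Or.inl ⟨y, hv, rfl⟩⟩
    · obtain ⟨v, hv⟩ := (hT _ ⟨p, hp, rfl⟩).1
      exact ⟨v, Or.inr ⟨hp, hv⟩⟩
  have hmem : ∀ y v, φ y ∈ openStar φ T v ↔ y.1 v ≠ 0 := by
    intro y v
    refine ⟨?_, fun h ↦ Or.inl ⟨y, h, rfl⟩⟩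
    rintro (⟨z, hz, hzy⟩ | ⟨h, -⟩)
    · rwa [← hφ.injective hzy]
    · exact absurd (mem_range_self y) h
  -- three stars with a common point come from three vertices of one face
  have hface : ∀ u v w, (openStar φ T u ∩ openStar φ T v ∩ openStar φ T w).Nonempty →
      ∃ s ∈ K.faces, u ∈ s ∧ v ∈ s ∧ w ∈ s := by
    rintro u v w ⟨p, ⟨hu, hv⟩, hw⟩
    by_cases hp : p ∈ range φ
    · obtain ⟨y, rfl⟩ := hp
      rw [hmem] at hu hv hw
      obtain ⟨s, hs, hy⟩ := mem_iUnion₂.1 y.2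
      exact ⟨s, hs, not_imp_comm.1 (hy.2 u) hu, not_imp_comm.1 (hy.2 v) hv,
        not_imp_comm.1 (hy.2 w) hw⟩
    · have aux : ∀ x, p ∈ openStar φ T x → x ∈ T (connectedComponentIn (range φ)ᶜ p) := fun x hx ↦
        (hx.resolve_left fun h ↦ hp (image_subset_range _ _ h)).2
      exact (hT _ ⟨p, hp, rfl⟩).2.1 u (aux u hu) v (aux v hv) w (aux w hw)
  obtain ⟨h, hcont, hh⟩ := exists_primitive_sphere
    (isOpen_openStar hφ fun U hU ↦ (hT U hU).2.2) hcov fun u v w hn ↦ hc u v w (hface u v w hn)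
  have hvert : ∀ v, (Pi.single v 1 : V → ℝ) ∈ realization K := fun v ↦
    closedSimplex_subset_realization (K.singleton_mem v)
      (single_mem_closedSimplex (Finset.mem_singleton_self v))
  -- inside a closed simplex the open star of a vertex is convex, so `h v` is constant on it
  have hconst : ∀ s (hs : s ∈ K.faces), ∀ v ∈ s, ∀ y (hy : y ∈ closedSimplex s), y v ≠ 0 →
      h v (φ ⟨y, closedSimplex_subset_realization hs hy⟩) = h v (φ ⟨_, hvert v⟩) := by
    intro s hs v hv y hy hyv
    have hconv : IsPreconnected (closedSimplex s ∩ {x : V → ℝ | 0 < x v}) :=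
      ((convex_closedSimplex s).inter
        (convex_halfSpace_gt (LinearMap.proj (R := ℝ) (φ := fun _ : V ↦ ℝ) v).isLinear
          0)).isPreconnected
    have himg : ((↑) : realization K → V → ℝ) '' ((↑) ⁻¹' (closedSimplex s ∩ {x | 0 < x v})) =
        closedSimplex s ∩ {x | 0 < x v} := by
      rw [Subtype.image_preimage_coe, inter_eq_right]
      exact inter_subset_left.trans (closedSimplex_subset_realization hs)
    rw [← himg, IsInducing.subtypeVal.isPreconnected_image] at hconv
    refine hconv.constant (f := h v ∘ φ) ((hcont v).comp hφ.continuous.continuousOn ?_)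
      ⟨hy, (hy.1.1 v).lt_of_ne hyv.symm⟩ ⟨single_mem_closedSimplex hv, by simp⟩
    exact fun z hz ↦ (hmem z v).2 (ne_of_gt hz.2)
  refine ⟨fun v ↦ h v (φ ⟨_, hvert v⟩), fun s hs u hu v hv ↦ ?_⟩
  -- compare the two values at the midpoint of the edge
  obtain ⟨m, hm, hmu, hmv⟩ : ∃ m ∈ closedSimplex s, m u ≠ 0 ∧ m v ≠ 0 := by
    refine ⟨(1 / 2 : ℝ) • Pi.single u 1 + (1 / 2 : ℝ) • Pi.single v 1,
      convex_closedSimplex s (single_mem_closedSimplex hu) (single_mem_closedSimplex hv)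
        (by norm_num) (by norm_num) (by norm_num), ?_, ?_⟩
    all_goals
      rcases eq_or_ne u v with rfl | huv
      · norm_num
      · simp [huv, huv.symm]
  dsimp only
  rw [← hconst s hs u hu m hm hmu, ← hconst s hs v hv m hm hmv]
  exact hh u v _ ((hmem _ u).2 hmu) ((hmem _ v).2 hmv)

end Complex

/-! ### Colourings -/

section Colouring

variable {V : Type*} {K : AbstractSimplicialComplex V}

/-- Colour the vertices by the four elements of `ZMod 2 × ZMod 2` and each edge by the sum of the
colours of its ends, which is one of the three nonzero elements. -/
theorem colorable_spatialLineGraph (h : (oneSkeleton K).Colorable 4) :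
    (spatialLineGraph K).Colorable 3 := by
  classical
  have C : (oneSkeleton K).Coloring (ZMod 2 × ZMod 2) := h.toColoring (by decide)
  have hC : ∀ s ∈ K.faces, ∀ u ∈ s, ∀ v ∈ s, u ≠ v → C u ≠ C v := fun s hs u hu v hv huv ↦
    C.valid ⟨huv, {u, v}, (K.isRelLowerSet_faces hs).2 (Finset.insert_subset hu (by simpa using hv))
      ⟨u, by simp⟩, Finset.card_pair huv, by simp, by simp⟩
  have hne : ∀ e : Edge K, ∑ v ∈ e.1, C v ≠ 0 := by
    rintro ⟨e, he, hcard⟩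
    obtain ⟨u, v, huv, rfl⟩ := Finset.card_eq_two.1 hcard
    rw [Finset.sum_pair huv]
    have := hC _ he u (by simp) v (by simp) huv
    generalize C u = a, C v = b at this
    revert a b
    decide
  have D : (spatialLineGraph K).Coloring {g : ZMod 2 × ZMod 2 // g ≠ 0} := by
    refine SimpleGraph.Coloring.mk (fun e ↦ ⟨∑ v ∈ e.1, C v, hne e⟩) ?_
    rintro ⟨e, he, hec⟩ ⟨f, hf, hfc⟩ ⟨hef, t, ht, htc, het, hft⟩ heq
    obtain ⟨x, hx⟩ := Finset.card_eq_one.1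
      (show (t \ e).card = 1 by rw [Finset.card_sdiff_of_subset het, htc, hec])
    obtain ⟨y, hy⟩ := Finset.card_eq_one.1
      (show (t \ f).card = 1 by rw [Finset.card_sdiff_of_subset hft, htc, hfc])
    have hxt : x ∈ t := (Finset.mem_sdiff.1 (hx ▸ Finset.mem_singleton_self x)).1
    have hyt : y ∈ t := (Finset.mem_sdiff.1 (hy ▸ Finset.mem_singleton_self y)).1
    have hxy : x ≠ y := by
      rintro rfl
      refine hef (Subtype.ext ?_)
      rw [← Finset.sdiff_sdiff_eq_self het, hx, ← hy, Finset.sdiff_sdiff_eq_self hft]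
    have h1 := Finset.sum_sdiff (f := C) het
    have h2 := Finset.sum_sdiff (f := C) hft
    rw [hx, Finset.sum_singleton] at h1
    rw [hy, Finset.sum_singleton] at h2
    have h12 : ∑ v ∈ e, C v = ∑ v ∈ f, C v := congrArg Subtype.val heq
    exact hC t ht x hxt y hyt hxy (add_right_cancel ((h12 ▸ h1).trans h2.symm))
  exact D.colorable

/-- Three colours as the nonzero elements of `ZMod 2 × ZMod 2`: the three different colours of the
edges of a triangle then add up to zero, which makes the edge colouring a 1-cocycle. A vertex
function with this coboundary is a proper colouring. -/
theorem IsTriangulation.colorable_oneSkeleton [Fintype V] (hK : IsTriangulation K)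
    (h : (spatialLineGraph K).Colorable 3) : (oneSkeleton K).Colorable 4 := by
  classical
  obtain ⟨C⟩ := h
  let ψ : Fin 3 → ZMod 2 × ZMod 2 := ![(1, 0), (0, 1), (1, 1)]
  have hψ : ∀ i, ψ i ≠ 0 := by decide
  have hψ3 : ∀ i j k, i ≠ j → j ≠ k → i ≠ k → ψ i + ψ j = ψ k := by decide
  have h2 : ∀ g : ZMod 2 × ZMod 2, g + g = 0 := by decide
  let f : Finset V → ZMod 2 × ZMod 2 := fun e ↦
    if he : e ∈ K.faces ∧ e.card = 2 then ψ (C ⟨e, he⟩) else 0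
  have hf : ∀ e (he : e ∈ K.faces ∧ e.card = 2), f e = ψ (C ⟨e, he⟩) := fun e he ↦ dif_pos he
  have hf1 : ∀ u, f {u, u} = 0 := fun u ↦ dif_neg (by simp)
  have hpair : ∀ s ∈ K.faces, ∀ u ∈ s, ∀ v ∈ s, u ≠ v →
      ({u, v} : Finset V) ∈ K.faces ∧ ({u, v} : Finset V).card = 2 := fun s hs u hu v hv huv ↦
    ⟨(K.isRelLowerSet_faces hs).2 (Finset.insert_subset hu (by simpa using hv)) ⟨u, by simp⟩,
      Finset.card_pair huv⟩
  obtain ⟨a, ha⟩ := hK.exists_coboundary (c := fun u v ↦ f {u, v}) (by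
    rintro u v w ⟨s, hs, hu, hv, hw⟩
    by_cases huv : u = v
    · rw [huv, hf1, zero_add]
    by_cases hvw : v = w
    · rw [hvw, hf1, add_zero]
    by_cases huw : u = w
    · rw [huw, hf1, Finset.pair_comm, h2]
    have ht : ({u, v, w} : Finset V) ∈ K.faces := (K.isRelLowerSet_faces hs).2
      (by simp [Finset.insert_subset_iff, hu, hv, hw]) ⟨u, by simp⟩
    have htc : ({u, v, w} : Finset V).card = 3 := Finset.card_eq_three.2
      ⟨u, v, w, huv, huw, hvw, rfl⟩
    rw [hf _ (hpair s hs u hu v hv huv), hf _ (hpair s hs v hv w hw hvw),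
      hf _ (hpair s hs u hu w hw huw)]
    have hC : ∀ (e f : Edge K) (x : V), e.1 ⊆ {u, v, w} → f.1 ⊆ {u, v, w} → x ∈ e.1 → x ∉ f.1 →
        C e ≠ C f := fun e f x he hf hxe hxf ↦
      C.valid ⟨fun h ↦ hxf (h ▸ hxe), _, ht, htc, he, hf⟩
    refine hψ3 _ _ _ (hC _ _ u ?_ ?_ ?_ ?_) (hC _ _ v ?_ ?_ ?_ ?_) (hC _ _ v ?_ ?_ ?_ ?_)
    all_goals simp [Finset.insert_subset_iff, huv, hvw, huw, Ne.symm huv])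
  have D : (oneSkeleton K).Coloring (ZMod 2 × ZMod 2) := by
    refine SimpleGraph.Coloring.mk a ?_
    rintro u v ⟨huv, e, he, -, hu, hv⟩ heq
    have := ha e he u hu v hv
    rw [hf _ (hpair e he u hu v hv huv), heq, left_eq_add] at this
    exact hψ _ this
  exact D.colorable

end Colouring

end ThreeSpace

theorem mainTheorem2 {V : Type*} [Fintype V] (K : AbstractSimplicialComplex V)
    (hK : ThreeSpace.IsTriangulation K) :
    (ThreeSpace.oneSkeleton K).Colorable 4 ↔ (ThreeSpace.spatialLineGraph K).Colorable 3 :=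
  ⟨ThreeSpace.colorable_spatialLineGraph, hK.colorable_oneSkeleton⟩
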